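/- Let $\Lambda$ and $\Gamma$ be left and right noetherian rings, and let ${}_\Lambda U_\Gamma$ be a bimodule such that ${}_\Lambda U$ is a Wakamatsu tilting module with $\Gamma=\mathrm{End}({}_\Lambda U)$ (acting on the right). That is: ${}_\Lambda U$ is finitely generated, $\mathrm{Ext}^i_\Lambda(U,U)=0$ for all $i\ge 1$, and there is an exact sequence $0\to\Lambda\to U_0\to U_1\to\cdots$ in which each $U_i$ is a direct summand of a finite direct sum of copies of ${}_\Lambda U$ and which remains exact under $\mathrm{Hom}_\Lambda(-,U)$. Let $0\to{}_\Lambda U\to E_0\to E_1\to\cdots$ and $0\to U_\Gamma\to E_0'\to E_1'\to\cdots$ be minimal injective resolutions of ${}_\Lambda U$ and of $U_\Gamma$. Notation and conventions, stated for $\Lambda$-modules and used analogously for right $\Gamma$-modules: - $\mathrm{mod}\,\Lambda$ is the category of finitely generated left $\Lambda$-modules, and $\mathrm{mod}\,\Gamma^{op}$ the category of finitely generated right $\Gamma$-modules. - $\text{add-lim}\,{}_\Lambda U$ is the class of all $\Lambda$-modules isomorphic to a direct summand of a direct limit of modules each of which is a finite direct sum of copies of ${}_\Lambda U$. - For $k\ge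 1$, $U\text{-dom.dim}({}_\Lambda M)\ge k$ means that each of the first $k$ terms of a minimal injective resolution of $M$ can be embedded into a direct limit of modules each of which is a finite direct sum of copies of ${}_\Lambda U$. - $\mathrm{s.grade}_U X\ge n$ means that $\mathrm{Ext}^i(Y,U)=0$ for every submodule $Y$ of $X$ and all $0\le i<n$. - $(-)^*$ is $\mathrm{Hom}_\Lambda(-,U)$ on left $\Lambda$-modules and $\mathrm{Hom}_\Gamma(-,U)$ on right $\Gamma$-modules, and $(-)^{**}$ is the double dual. For a left $\Lambda$-module $M$, the groups $\mathrm{Ext}^i_\Lambda(M,U)$ are right $\Gamma$-modules through the action of $\Gamma$ on $U$; for a right $\Gamma$-module $N$, the groups $\mathrm{Ext}^i_\Gamma(N,U)$ are left $\Lambda$-modules through the action of $\Lambda$ on $U$. Then the following statements are equivalent. 1. $U\text{-dom.dim}({}_\Lambda U)\ge 1$. 2. $\mathrm{s.grade}_U\,\mathrm{Ext}^1_\Lambda(M,U)\ge 1$ for every $M\in\mathrm{mod}\,\Lambda$. 3. $E_0\in\text{add-lim}\,{}_\Lambda U$. 4. $(-)^{**}$ preserves monomorphisms in $\mathrm{mod}\,\Lambda$.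 5. $U\text{-dom.dim}(U_\Gamma)\ge 1$. 6. $\mathrm{s.grade}_U\,\mathrm{Ext}^1_\Gamma(N,U)\ge 1$ for every $N\in\mathrm{mod}\,\Gamma^{op}$. 7. $E_0'\in\text{add-lim}\,U_\Gamma$. 8. $(-)^{**}$ preserves monomorphisms in $\mathrm{mod}\,\Gamma^{op}$. -/

import Mathlib

universe u

namespace UDom

open CategoryTheory

section OneSided

variable (R : Type u) [Ring R] (T : Type u) [AddCommGroup T] [Module R T]

/-- `X` lies in `add T`: it is (isomorphic to) a direct summand of a finite direct sum of copies
of `T`. -/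
def IsInAdd (X : Type u) [AddCommGroup X] [Module R X] : Prop :=
  ∃ (n : ℕ) (s : X →ₗ[R] (Fin n → T)) (p : (Fin n → T) →ₗ[R] X), p ∘ₗ s = LinearMap.id

open Classical in
/-- `L` is a direct limit (over a nonempty directed preordered set) of a family of modules, each
of which is a finite direct sum of copies of `T`. -/
def IsDirectLimitOfCopies (L : Type u) [AddCommGroup L] [Module R L] : Prop :=
  ∃ (ι : Type u) (_ : Preorder ι) (_ : IsDirectedOrder ι) (_ : Nonempty ι) (n : ι → ℕ)
    (f : ∀ i j, i ≤ j → (Fin (n i) → T) →ₗ[R] (Fin (n j) → T))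
    (_ : DirectedSystem (fun i => Fin (n i) → T) fun i j h => f i j h),
    Nonempty (L ≃ₗ[R] Module.DirectLimit (fun i => Fin (n i) → T) f)

/-- `X` lies in `add-lim T`: it is isomorphic to a direct summand of a direct limit of finite
direct sums of copies of `T`. -/
def IsInAddLim (X : Type u) [AddCommGroup X] [Module R X] : Prop :=
  ∃ L : ModuleCat.{u} R, IsDirectLimitOfCopies R T L ∧
    ∃ (s : X →ₗ[R] L) (p : L →ₗ[R] X), p ∘ₗ s = LinearMap.id

/-- `X` can be embedded into a direct limit of finite direct sums of copies of `T`. -/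
def EmbedsInDirectLimit (X : Type u) [AddCommGroup X] [Module R X] : Prop :=
  ∃ L : ModuleCat.{u} R, IsDirectLimitOfCopies R T L ∧
    ∃ s : X →ₗ[R] L, Function.Injective s

/-- A submodule is essential if it meets every nonzero submodule nontrivially. -/
def IsEssential {R : Type u} [Ring R] {X : Type u} [AddCommGroup X] [Module R X]
    (N : Submodule R X) : Prop :=
  ∀ P : Submodule R X, N ⊓ P = ⊥ → P = ⊥

/-- A minimal injective resolution `0 → M → E 0 → E 1 → ⋯`: an exact sequence with all `E i`
injective, in which the image of each map is essential in its target. In particular `E 0` is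
the injective envelope of `M`. -/
structure MinimalInjectiveResolution (M : Type u) [AddCommGroup M] [Module R M] where
  /-- the terms -/
  E : ℕ → ModuleCat.{u} R
  /-- the augmentation -/
  aug : M →ₗ[R] E 0
  /-- the differentials -/
  d : ∀ i, E i →ₗ[R] E (i + 1)
  injective : ∀ i, Module.Injective R (E i)
  aug_injective : Function.Injective aug
  exact_zero : Function.Exact aug (d 0)
  exact_succ : ∀ i, Function.Exact (d i) (d (i + 1))
  essential_zero : IsEssential (LinearMap.range aug)
  essential_succ : ∀ i, IsEssential (LinearMap.range (d i))

/-- `T-dom.dim M ≥ k`: each of the first `k` terms in a minimal injective resolution of `M` can be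
embedded into a direct limit of finite direct sums of copies of `T`.  (A minimal injective
resolution is unique up to isomorphism.) -/
def DomDimGE (M : Type u) [AddCommGroup M] [Module R M] (k : ℕ) : Prop :=
  ∃ I : MinimalInjectiveResolution R M, ∀ i < k, EmbedsInDirectLimit R T (I.E i)

/-- `grade_T X ≥ n`: `Ext^i(X, T) = 0` for all `0 ≤ i < n`. -/
def GradeGE (X : Type u) [AddCommGroup X] [Module R X] (n : ℕ) : Prop :=
  ∀ i < n, Subsingleton (Abelian.Ext.{u} (ModuleCat.of R X) (ModuleCat.of R T) i)

/-- `s.grade_T X ≥ n`: every submodule of `X` has grade at least `n` with respect to `T`. -/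
def StrongGradeGE (X : Type u) [AddCommGroup X] [Module R X] (n : ℕ) : Prop :=
  ∀ Y : Submodule R X, GradeGE R T Y n

/-- `T` is a Wakamatsu tilting module: it is finitely generated, self-orthogonal, and there is an
exact sequence `0 → R → X 0 → X 1 → ⋯` with all `X i` in `add T` that stays exact under
`Hom(-, T)`. -/
structure IsWakamatsuTilting : Prop where
  finite : Module.Finite R T
  selfOrthogonal : ∀ i, 1 ≤ i →
    Subsingleton (Abelian.Ext.{u} (ModuleCat.of R T) (ModuleCat.of R T) i)
  coresolution : ∃ (X : ℕ → ModuleCat.{u} R) (a : R →ₗ[R] X 0) (d : ∀ i, X i →ₗ[R] X (i + 1)),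
    (∀ i, IsInAdd R T (X i)) ∧
    Function.Injective a ∧ Function.Exact a (d 0) ∧ (∀ i, Function.Exact (d i) (d (i + 1))) ∧
    Function.Surjective (fun φ : X 0 →ₗ[R] T => φ ∘ₗ a) ∧
    Function.Exact (fun φ : X 1 →ₗ[R] T => φ ∘ₗ d 0) (fun φ : X 0 →ₗ[R] T => φ ∘ₗ a) ∧
    ∀ i, Function.Exact (fun φ : X (i + 1 + 1) →ₗ[R] T => φ ∘ₗ d (i + 1))
      (fun φ : X (i + 1) →ₗ[R] T => φ ∘ₗ d i)

end OneSided

section TwoSided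

/- `U` carries two commuting left module structures, over `A` and over `B`.  A `Λ`-`Γ`-bimodule is
the case `A = Λ`, `B = Γᵐᵒᵖ`. (The two commutation conditions below are equivalent.) -/
variable (A B : Type u) [Ring A] [Ring B] (U : Type u) [AddCommGroup U] [Module A U] [Module B U]
  [SMulCommClass A B U] [SMulCommClass B A U]

/-- Multiplication by `b : B` on `U`, as an endomorphism of the `A`-module `U`. -/
def mulHom (b : B) : ModuleCat.of A U ⟶ ModuleCat.of A U :=
  ModuleCat.ofHom (Module.toModuleEnd A U b)

/-- The action of `B` on `Ext^n_A(M, U)` by functoriality in `U`. -/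
noncomputable abbrev extModule (M : ModuleCat.{u} A) (n : ℕ) :
    Module B (Abelian.Ext.{u} M (ModuleCat.of A U) n) where
  smul b x := x.comp (Abelian.Ext.mk₀ (mulHom A B U b)) (add_zero n)
  one_smul x := by
    have h1 : mulHom A B U 1 = 𝟙 _ := by
      ext y; exact one_smul B y
    change x.comp (Abelian.Ext.mk₀ (mulHom A B U 1)) _ = x
    rw [h1]; exact Abelian.Ext.comp_mk₀_id _
  mul_smul b c x := by
    have h1 : mulHom A B U (b * c) = mulHom A B U c ≫ mulHom A B U b := by
      ext y; exact mul_smul b c y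
    change x.comp (Abelian.Ext.mk₀ (mulHom A B U (b * c))) _ =
      (x.comp (Abelian.Ext.mk₀ (mulHom A B U c)) _).comp (Abelian.Ext.mk₀ (mulHom A B U b)) _
    rw [h1, ← Abelian.Ext.mk₀_comp_mk₀, Abelian.Ext.comp_assoc_of_third_deg_zero]
  smul_zero b := Abelian.Ext.zero_comp _ _ _ _ (add_zero n)
  smul_add b x y := Abelian.Ext.add_comp x y _ (add_zero n)
  add_smul b c x := by
    have h1 : mulHom A B U (b + c) = mulHom A B U b + mulHom A B U c := by
      ext y; exact add_smul b c y
    change x.comp (Abelian.Ext.mk₀ (mulHom A B U (b + c))) _ =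
      x.comp (Abelian.Ext.mk₀ (mulHom A B U b)) _ + x.comp (Abelian.Ext.mk₀ (mulHom A B U c)) _
    rw [h1, Abelian.Ext.mk₀_add, Abelian.Ext.comp_add]
  zero_smul x := by
    have h1 : mulHom A B U 0 = 0 := by
      ext y; exact zero_smul B y
    change x.comp (Abelian.Ext.mk₀ (mulHom A B U 0)) _ = 0
    rw [h1, Abelian.Ext.mk₀_zero, Abelian.Ext.comp_zero]

/-- `Ext^n_A(M, U)`, regarded as a `B`-module by the instances below. -/
def ExtU (_B : Type u) (M : Type u) [AddCommGroup M] [Module A M] (n : ℕ) : Type u :=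
  Abelian.Ext.{u} (ModuleCat.of A M) (ModuleCat.of A U) n

noncomputable instance (M : Type u) [AddCommGroup M] [Module A M] (n : ℕ) :
    AddCommGroup (ExtU A U B M n) :=
  inferInstanceAs (AddCommGroup (Abelian.Ext.{u} (ModuleCat.of A M) (ModuleCat.of A U) n))

noncomputable instance (M : Type u) [AddCommGroup M] [Module A M] (n : ℕ) :
    Module B (ExtU A U B M n) :=
  extModule A B U (ModuleCat.of A M) n

/-- For every finitely generated `A`-module `M`, the strong grade with respect to `U` of the
`B`-module `Ext^i_A(M, U)` is at least `n`. -/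
def StrongGradeExtGE (i n : ℕ) : Prop :=
  ∀ (M : Type u) [AddCommGroup M] [Module A M] [Module.Finite A M],
    StrongGradeGE B U (ExtU A U B M i) n

/-- For `f : M → N`, the dual map `f^* : Hom_A(N, U) → Hom_A(M, U)`, a map of `B`-modules. -/
def dualMap {M N : Type u} [AddCommGroup M] [Module A M] [AddCommGroup N] [Module A N]
    (f : M →ₗ[A] N) : (N →ₗ[A] U) →ₗ[B] (M →ₗ[A] U) where
  toFun φ := φ ∘ₗ f
  map_add' _ _ := rfl
  map_smul' _ _ := rfl

/-- For `f : M → N`, the double dual map `f^{**} : M^{**} → N^{**}`, where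
`M^{**} = Hom_B(Hom_A(M, U), U)`. -/
def doubleDualMap {M N : Type u} [AddCommGroup M] [Module A M] [AddCommGroup N] [Module A N]
    (f : M →ₗ[A] N) : ((M →ₗ[A] U) →ₗ[B] U) →ₗ[A] ((N →ₗ[A] U) →ₗ[B] U) :=
  dualMap B A U (dualMap A B U f)

/-- The double dual functor preserves monomorphisms between finitely generated `A`-modules. -/
def DoubleDualPreservesMono : Prop :=
  ∀ (M N : Type u) [AddCommGroup M] [Module A M] [AddCommGroup N] [Module A N]
    [Module.Finite A M] [Module.Finite A N] (f : M →ₗ[A] N),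
    Function.Injective f → Function.Injective (doubleDualMap A B U f)

end TwoSided

end UDom

/-! The eight statements form one cycle 3 → 1 → 6 → 8 → 7 → 5 → 2 → 4 → 3. Its second half is its
first half with the two rings exchanged. The exchange is legitimate because `U` is also finitely
generated over `Γ` and `Λ` is in turn the endomorphism ring of `U_Γ`; both come from the start of
the coresolution of `Λ`.

The pivot is an elementary property of `E₀`: its finitely generated submodules are cogenerated by
`U`. An embedding of `E₀` in a direct limit of powers of `U` gives this property. Since `Γ =
End(U)`, it forces the strong grade condition on the other side. That condition, unwound through a
presentation `Aⁿ / K` and the connecting map, says that a nonzero `u` is never annihilated by all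
scalars that make some `φ : K → U` extendable; this makes double duals preserve monomorphisms.
Applied to `U → X + U` with `X ⊆ E₀` finitely generated, preservation returns the pivot for the
envelope on that side. Finally the pivot and injectivity make every map from a finitely generated
module to `E₀` factor through some `Uⁿ`, so Lazard's argument presents `E₀` as a direct limit of
such powers. -/

namespace UDom

section

variable (R : Type u) [Ring R] (T : Type u) [AddCommGroup T] [Module R T]
variable (E : Type u) [AddCommGroup E] [Module R E]

/-- Every finitely generated submodule of `E` is cogenerated by `T`. -/
def FGSubmodulesTorsionless : Prop :=
  ∀ X : Submodule R E, X.FG → ∀ x : X, (∀ g : X →ₗ[R] T, g x = 0) → x = 0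

end

section

variable (A B : Type u) [Ring A] [Ring B] (U : Type u) [AddCommGroup U] [Module A U] [Module B U]
  [SMulCommClass A B U] [SMulCommClass B A U]

/-- An elementary form of the condition that no submodule of `Ext¹_A(M, U)` has a nonzero map to
`U`: here `M` is presented as `Aⁿ / K`, and a class is represented by `φ : K → U`. -/
def ExtensionObstructionsDetect : Prop :=
  ∀ (n : ℕ) (K : Submodule A (Fin n → A)) (φ : K →ₗ[A] U) (u : U),
    (∀ b : B, (∃ g : (Fin n → A) →ₗ[A] U, g ∘ₗ K.subtype = b • φ) → b • u = 0) → u = 0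

end

/-! ### Torsionless submodules, extension obstructions and double duals -/

theorem exists_linearMap_apply_eq_of_injective {R E T : Type u} [Ring R] [AddCommGroup E]
    [Module R E] [AddCommGroup T] [Module R T] [Module.Injective R E] (t : T) (e : E)
    (h : ∀ a : R, a • t = 0 → a • e = 0) : ∃ f : T →ₗ[R] E, f t = e := by
  let k := LinearMap.ker (LinearMap.toSpanSingleton R T t)
  let i : (R ⧸ k) →ₗ[R] T := k.liftQ (LinearMap.toSpanSingleton R T t) le_rfl
  let j : (R ⧸ k) →ₗ[R] E := k.liftQ (LinearMap.toSpanSingleton R E e) (by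
    intro a ha
    simp only [k, LinearMap.mem_ker, LinearMap.toSpanSingleton_apply] at ha ⊢
    exact h a ha)
  have hi : Function.Injective i := by
    rw [← LinearMap.ker_eq_bot]
    exact Submodule.ker_liftQ_eq_bot _ _ _ le_rfl
  obtain ⟨f, hf⟩ := Module.Injective.out i hi j
  refine ⟨f, ?_⟩
  have := hf (k.mkQ 1)
  simpa [i, j] using this

variable {A B : Type u} [Ring A] [Ring B] {U : Type u} [AddCommGroup U] [Module A U] [Module B U]

/-- This is where sides are exchanged. Record `φ` by its values `y` on generators of `K`. The
hypothesis on `u` says that the annihilator of `y` modulo the extendable tuples kills `u`, so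
injectivity of `E` sends the class of `y` to `aug u`. Every functional on the resulting finitely
generated image turns out to vanish there. -/
theorem extensionObstructionsDetect_of_fgSubmodulesTorsionless [SMulCommClass B A U]
    [IsNoetherianRing B] [Module.Finite A U]
    (hB : Function.Bijective (Module.toModuleEnd A U : B →+* Module.End A U))
    {E : Type u} [AddCommGroup E] [Module A E] [Module.Injective A E] (aug : U →ₗ[A] E)
    (haug : Function.Injective aug) (hE : FGSubmodulesTorsionless A U E) :
    ExtensionObstructionsDetect B A U := by
  intro n K φ u h
  obtain ⟨m, k, hk⟩ := Submodule.fg_iff_exists_fin_generating_family.1 (IsNoetherian.noetherian K)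
  have hkK (i) : k i ∈ K := hk ▸ Submodule.subset_span ⟨i, rfl⟩
  let ev : ((Fin n → B) →ₗ[B] U) →ₗ[A] (Fin m → U) :=
    { toFun := fun g i => g (k i)
      map_add' := fun _ _ => rfl
      map_smul' := fun _ _ => rfl }
  let y : Fin m → U := fun i => φ ⟨k i, hkK i⟩
  obtain ⟨f, hf⟩ := exists_linearMap_apply_eq_of_injective (R := A)
    ((LinearMap.range ev).mkQ y) (aug u) (by
      intro a ha
      rw [← map_smul, Submodule.mkQ_apply, Submodule.Quotient.mk_eq_zero] at ha
      obtain ⟨g, hg⟩ := ha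
      rw [← map_smul, h a, map_zero]
      refine ⟨g, LinearMap.ext fun x => ?_⟩
      obtain ⟨x, hx⟩ := x
      have hx' := hx
      rw [← hk] at hx'
      change g x = a • φ ⟨x, hx⟩
      induction hx' using Submodule.span_induction with
      | mem x hx' =>
        obtain ⟨i, rfl⟩ := hx'
        exact congrFun hg i
      | zero =>
        rw [map_zero, show (⟨0, hx⟩ : K) = 0 from rfl, map_zero, smul_zero]
      | add x z hx1 hz1 ihx ihz =>
        rw [hk] at hx1 hz1
        rw [map_add, ihx hx1, ihz hz1, ← smul_add, ← map_add]
        rfl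
      | smul b x hx1 ihx =>
        rw [hk] at hx1
        rw [map_smul, ihx hx1, smul_comm, ← map_smul]
        rfl)
  have hX : (LinearMap.range f).FG := Module.Finite.iff_fg.1 inferInstance
  have key := hE _ hX ⟨aug u, _, hf⟩ (fun g => by
    let G : (Fin m → U) →ₗ[A] U := g ∘ₗ f.rangeRestrict ∘ₗ (LinearMap.range ev).mkQ
    -- As `B` is the whole endomorphism ring, a functional on `Uᵐ` is a tuple of scalars, which
    -- turns the functional into an element `x` of `K`.
    choose b hb using fun i => hB.2 (G ∘ₗ LinearMap.single A (fun _ => U) i)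
    have hG (z : Fin m → U) : G z = ∑ i, b i • z i := by
      conv_lhs => rw [← Finset.univ_sum_single z, map_sum]
      refine Finset.sum_congr rfl fun i _ => ?_
      exact (LinearMap.congr_fun (hb i) (z i)).symm
    let x : K := ∑ i, b i • ⟨k i, hkK i⟩
    have hx (ψ : (Fin n → B) →ₗ[B] U) : ψ x = 0 := by
      have h1 : G (ev ψ) = 0 := by
        have : (LinearMap.range ev).mkQ (ev ψ) = 0 :=
          (Submodule.Quotient.mk_eq_zero _).2 ⟨ψ, rfl⟩
        change g (f.rangeRestrict ((LinearMap.range ev).mkQ (ev ψ))) = 0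
        rw [this, map_zero, map_zero]
      rw [hG] at h1
      simpa [x, ev] using h1
    -- The functionals `z ↦ z j • w` on `Bⁿ` all kill `x`, and `B` acts faithfully on `U`.
    have hx0 : x = 0 := by
      apply Subtype.ext
      funext j
      apply hB.1
      ext w
      have := hx (LinearMap.toSpanSingleton B U w ∘ₗ LinearMap.proj j)
      simpa using this
    have hGy : G y = 0 := by
      rw [hG]
      have : φ x = ∑ i, b i • y i := by simp only [x, y, map_sum, map_smul]
      rw [← this, hx0, map_zero]
    have : (⟨aug u, _, hf⟩ : LinearMap.range f) = f.rangeRestrict ((LinearMap.range ev).mkQ y) :=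
      Subtype.ext hf.symm
    rw [this]
    exact hGy)
  apply haug
  rw [map_zero]
  exact congrArg Subtype.val key

/-- Cover `N` by `Aⁿ` and pull `φ : M → U` back to the preimage `K` of `M`. If `b • φ'` extends to
`Aⁿ`, the extension kills `ker π`, so `b • φ` extends to `N`, and `ξ`, which kills all restrictions
from `N`, satisfies `b • ξ φ = 0`. -/
theorem doubleDualPreservesMono_of_extensionObstructionsDetect [SMulCommClass A B U]
    [SMulCommClass B A U] (h : ExtensionObstructionsDetect A B U) : DoubleDualPreservesMono A B U := by
  intro M N _ _ _ _ _ _ f hf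
  rw [injective_iff_map_eq_zero]
  intro ξ hξ
  ext φ
  obtain ⟨n, π, hπ⟩ := Module.Finite.exists_fin' A N
  let K := (LinearMap.range f).comap π
  let e := LinearEquiv.ofInjective f hf
  let φ' : K →ₗ[A] U := φ ∘ₗ e.symm.toLinearMap ∘ₗ π.restrict (p := K) (fun x hx => hx)
  have hφ' (x : K) (m : M) (hm : f m = π x) : φ' x = φ m := by
    have : π.restrict (p := K) (q := LinearMap.range f) (fun x hx => hx) x = e m :=
      Subtype.ext hm.symm
    simp [φ', this]
  refine h n K φ' (ξ φ) ?_
  rintro b ⟨g, hg⟩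
  have hker : LinearMap.ker π ≤ LinearMap.ker g := by
    intro x hx
    rw [LinearMap.mem_ker] at hx ⊢
    have hxK : x ∈ K := by
      change π x ∈ LinearMap.range f
      rw [hx]; exact zero_mem _
    have := LinearMap.congr_fun hg ⟨x, hxK⟩
    change g x = b • φ' ⟨x, hxK⟩ at this
    rw [this, hφ' _ 0 (by simp [hx]), map_zero, smul_zero]
  let γ : N →ₗ[A] U := (LinearMap.ker π).liftQ g hker ∘ₗ
    (π.quotKerEquivOfSurjective hπ).symm.toLinearMap
  have hγ (x) : γ (π x) = g x := by
    have : (π.quotKerEquivOfSurjective hπ).symm (π x) = (LinearMap.ker π).mkQ x := by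
      rw [LinearEquiv.symm_apply_eq]; rfl
    simp [γ, this]
  have hb : b • φ = dualMap A B U f γ := by
    ext m
    obtain ⟨x, hx⟩ := hπ (f m)
    have hxK : x ∈ K := ⟨m, hx.symm⟩
    change b • φ m = γ (f m)
    rw [← hx, hγ, ← hφ' ⟨x, hxK⟩ m hx.symm]
    exact (LinearMap.congr_fun hg ⟨x, hxK⟩).symm
  rw [← map_smul, hb]
  exact LinearMap.congr_fun hξ γ

/-- The common kernel `P` of all functionals on `X + U` meets `U` trivially: evaluation at a point
`w` of the intersection is a double dual element killed by `f^{**}`, hence zero, and the identity of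
`U` gives `w = 0`. Essentiality then kills `P`. -/
theorem fgSubmodulesTorsionless_of_doubleDualPreservesMono [SMulCommClass A B U]
    [SMulCommClass B A U] [Module.Finite A U] {E : Type u} [AddCommGroup E] [Module A E] (aug : U →ₗ[A] E)
    (haug : Function.Injective aug) (hess : IsEssential (LinearMap.range aug))
    (h : DoubleDualPreservesMono A B U) : FGSubmodulesTorsionless A U E := by
  intro X hX
  let X' := X ⊔ LinearMap.range aug
  have hX' : X'.FG := hX.sup (Module.Finite.iff_fg.1 inferInstance)
  have : Module.Finite A X' := Module.Finite.iff_fg.2 hX'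
  let f : U →ₗ[A] X' := aug.codRestrict X' fun x => Submodule.mem_sup_right ⟨x, rfl⟩
  have hf : Function.Injective f := fun x y hxy => haug (congrArg Subtype.val hxy)
  let P : Submodule A X' := ⨅ g : X' →ₗ[A] U, LinearMap.ker g
  have hP : P.map X'.subtype = ⊥ := by
    apply hess
    rw [Submodule.eq_bot_iff]
    rintro _ ⟨⟨w, rfl⟩, ⟨x, hx, hxw⟩⟩
    have hxf : x = f w := Subtype.ext hxw
    let ev : (U →ₗ[A] U) →ₗ[B] U :=
      { toFun := fun φ => φ w
        map_add' := fun _ _ => rfl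
        map_smul' := fun _ _ => rfl }
    have hev : ev = 0 := by
      apply h U X' f hf
      rw [map_zero]
      ext g
      have := (Submodule.mem_iInf _).1 hx g
      rw [hxf] at this
      exact this
    have : w = 0 := LinearMap.congr_fun hev LinearMap.id
    rw [this, map_zero]
  intro x hx
  have hxP : (⟨x, Submodule.mem_sup_left x.2⟩ : X') ∈ P := by
    refine (Submodule.mem_iInf _).2 fun g => ?_
    exact hx (g ∘ₗ Submodule.inclusion le_sup_left)
  have : (x : E) ∈ P.map X'.subtype := ⟨_, hxP, rfl⟩
  rw [hP, Submodule.mem_bot] at this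
  exact Subtype.ext this

/-- The dual of `X` embeds in a power of the noetherian `B`-module `U`, so it is finitely generated;
its generators already separate points. -/
theorem exists_injective_pi_of_torsionless [SMulCommClass A B U] [IsNoetherianRing B]
    [Module.Finite B U]
    {X : Type u} [AddCommGroup X] [Module A X] [Module.Finite A X]
    (hX : ∀ x : X, (∀ g : X →ₗ[A] U, g x = 0) → x = 0) :
    ∃ (n : ℕ) (j : X →ₗ[A] (Fin n → U)), Function.Injective j := by
  obtain ⟨m, π, hπ⟩ := Module.Finite.exists_fin' A X
  let ev : (X →ₗ[A] U) →ₗ[B] (Fin m → U) :=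
    { toFun := fun g i => g (π (Pi.single i 1))
      map_add' := fun _ _ => rfl
      map_smul' := fun _ _ => rfl }
  have hev : Function.Injective ev := by
    rw [injective_iff_map_eq_zero]
    intro g hg
    have : g ∘ₗ π = 0 := by
      refine LinearMap.pi_ext' fun i => LinearMap.ext_ring ?_
      exact congrFun hg i
    ext x
    obtain ⟨z, rfl⟩ := hπ x
    exact LinearMap.congr_fun this z
  have : IsNoetherian B (X →ₗ[A] U) := isNoetherian_of_injective ev hev
  obtain ⟨n, g, hg⟩ := Submodule.fg_iff_exists_fin_generating_family.1
    (IsNoetherian.noetherian (⊤ : Submodule B (X →ₗ[A] U)))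
  refine ⟨n, LinearMap.pi g, ?_⟩
  rw [injective_iff_map_eq_zero]
  intro x hx
  refine hX x fun φ => ?_
  have hφ : φ ∈ Submodule.span B (Set.range g) := hg ▸ Submodule.mem_top
  induction hφ using Submodule.span_induction with
  | mem φ h =>
    obtain ⟨i, rfl⟩ := h
    exact congrFun hx i
  | zero => rfl
  | add φ ψ _ _ h1 h2 => rw [LinearMap.add_apply, h1, h2, add_zero]
  | smul b φ _ h1 => rw [LinearMap.smul_apply, h1, smul_zero]

end UDom

/-! ### Direct limits of powers: Lazard's argument -/

namespace UDom

open CategoryTheory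

/-- Over a noetherian ring `X` is finitely presented: the generators lift to one stage, and the
finitely many relations die at a later one. -/
theorem exists_factor_through_directLimit {R : Type u} [Ring R] [IsNoetherianRing R]
    {ι : Type u} [Preorder ι] [IsDirectedOrder ι] [Nonempty ι] [DecidableEq ι]
    {G : ι → Type u} [∀ i, AddCommGroup (G i)] [∀ i, Module R (G i)]
    (f : ∀ i j, i ≤ j → G i →ₗ[R] G j) [DirectedSystem G fun i j h => f i j h]
    {X : Type u} [AddCommGroup X] [Module R X] [Module.Finite R X]
    (h : X →ₗ[R] Module.DirectLimit G f) :
    ∃ (i : ι) (g : X →ₗ[R] G i), Module.DirectLimit.of R ι G f i ∘ₗ g = h := by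
  obtain ⟨m, π, hπ⟩ := Module.Finite.exists_fin' R X
  choose i z hz using fun k : Fin m =>
    Module.DirectLimit.exists_of (h (π (Pi.single k 1)))
  obtain ⟨i₀, hi₀⟩ := Finite.exists_le i
  let l : (Fin m → R) →ₗ[R] G i₀ :=
    Fintype.linearCombination R fun k => f (i k) i₀ (hi₀ k) (z k)
  have hl : Module.DirectLimit.of R ι G f i₀ ∘ₗ l = h ∘ₗ π := by
    refine LinearMap.pi_ext' fun k => LinearMap.ext_ring ?_
    simp [l, Fintype.linearCombination_apply_single, Module.DirectLimit.of_f, hz]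
  obtain ⟨p, r, hr⟩ := Submodule.fg_iff_exists_fin_generating_family.1
    (IsNoetherian.noetherian (LinearMap.ker π))
  have hrπ (q) : π (r q) = 0 := by
    have : r q ∈ LinearMap.ker π := hr ▸ Submodule.subset_span ⟨q, rfl⟩
    exact this
  choose j hj hj0 using fun q : Fin p =>
    Module.DirectLimit.of.zero_exact (f := f) (i := i₀) (x := l (r q)) (by
      have := LinearMap.congr_fun hl (r q)
      simpa [hrπ] using this)
  obtain ⟨j₁, hj₁⟩ := Finite.exists_le j
  obtain ⟨j₀, hij, hjj⟩ := exists_ge_ge i₀ j₁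
  have hker : LinearMap.ker π ≤ LinearMap.ker (f i₀ j₀ hij ∘ₗ l) := by
    rw [← hr, Submodule.span_le]
    rintro _ ⟨q, rfl⟩
    change f i₀ j₀ hij (l (r q)) = 0
    rw [← DirectedSystem.map_map' f (hj q) ((hj₁ q).trans hjj)]
    rw [hj0, map_zero]
  refine ⟨j₀, (LinearMap.ker π).liftQ _ hker ∘ₗ (π.quotKerEquivOfSurjective hπ).symm.toLinearMap,
    ?_⟩
  ext x
  obtain ⟨y, rfl⟩ := hπ x
  have : (π.quotKerEquivOfSurjective hπ).symm (π y) = (LinearMap.ker π).mkQ y := by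
    rw [LinearEquiv.symm_apply_eq]; rfl
  have h2 := LinearMap.congr_fun hl y
  simp only [LinearMap.comp_apply] at h2
  simp [this, Module.DirectLimit.of_f, h2]

theorem fgSubmodulesTorsionless_of_embedsInDirectLimit {R : Type u} [Ring R] [IsNoetherianRing R]
    {T : Type u} [AddCommGroup T] [Module R T] {E : Type u} [AddCommGroup E] [Module R E]
    (hE : EmbedsInDirectLimit R T E) : FGSubmodulesTorsionless R T E := by
  classical
  obtain ⟨L, ⟨ι, _, _, _, n, f, _, ⟨e⟩⟩, s, hs⟩ := hE
  intro X hX x hx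
  have : Module.Finite R X := Module.Finite.iff_fg.2 hX
  obtain ⟨i, g, hg⟩ := exists_factor_through_directLimit f (e.toLinearMap ∘ₗ s ∘ₗ X.subtype)
  have hgx : g x = 0 := funext fun k => hx (LinearMap.proj k ∘ₗ g)
  have h := LinearMap.congr_fun hg x
  rw [LinearMap.comp_apply, hgx, map_zero] at h
  apply Subtype.ext
  apply hs
  apply e.injective
  simpa using h.symm

/-- Every map from a finitely generated module to `E` factors through a finite power of `T`. -/
def FactorsThroughPowers (R T E : Type u) [Ring R] [AddCommGroup T] [Module R T]
    [AddCommGroup E] [Module R E] : Prop :=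
  ∀ (X : Type u) [AddCommGroup X] [Module R X] [Module.Finite R X] (h : X →ₗ[R] E),
    ∃ (n : ℕ) (g : X →ₗ[R] (Fin n → T)) (k : (Fin n → T) →ₗ[R] E), k ∘ₗ g = h

/-- A finite power of `T` together with a map to `E`. -/
structure PowerOver (R T E : Type u) [Ring R] [AddCommGroup T] [Module R T]
    [AddCommGroup E] [Module R E] : Type u where
  /-- the exponent -/
  n : ℕ
  /-- the structure map -/
  toMap : (Fin n → T) →ₗ[R] E

section Lazard

variable {R T E : Type u} [Ring R] [AddCommGroup T] [Module R T] [AddCommGroup E] [Module R E]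

instance : SmallCategory (PowerOver R T E) where
  Hom c c' := {f : (Fin c.n → T) →ₗ[R] (Fin c'.n → T) // c'.toMap ∘ₗ f = c.toMap}
  id c := ⟨LinearMap.id, rfl⟩
  comp f g := ⟨g.1 ∘ₗ f.1, by rw [← LinearMap.comp_assoc, g.2, f.2]⟩

theorem PowerOver.comp_val {c c' c'' : PowerOver R T E} (f : c ⟶ c') (g : c' ⟶ c'') :
    (f ≫ g).1 = g.1 ∘ₗ f.1 := rfl

/-- Factoring the map from a direct sum gives upper bounds of objects; factoring the map from the
cokernel of `f - g` equalizes parallel arrows. -/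
theorem PowerOver.isFiltered [Module.Finite R T] (h : FactorsThroughPowers R T E) :
    IsFiltered (PowerOver R T E) where
  cocone_objs c c' := by
    obtain ⟨n, g, k, hk⟩ := h ((Fin c.n → T) × (Fin c'.n → T)) (c.toMap.coprod c'.toMap)
    refine ⟨⟨n, k⟩, ⟨g ∘ₗ LinearMap.inl R _ _, ?_⟩, ⟨g ∘ₗ LinearMap.inr R _ _, ?_⟩, trivial⟩
    · rw [← LinearMap.comp_assoc, hk, LinearMap.coprod_inl]
    · rw [← LinearMap.comp_assoc, hk, LinearMap.coprod_inr]
  cocone_maps c c' f g := by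
    obtain ⟨n, l, k, hk⟩ := h ((Fin c'.n → T) ⧸ LinearMap.range (f.1 - g.1))
      ((LinearMap.range (f.1 - g.1)).liftQ c'.toMap (by
        rintro _ ⟨x, rfl⟩
        have h1 := LinearMap.congr_fun f.2 x
        have h2 := LinearMap.congr_fun g.2 x
        simp only [LinearMap.comp_apply] at h1 h2
        simp [h1, h2]))
    refine ⟨⟨n, k⟩, ⟨l ∘ₗ Submodule.mkQ _, ?_⟩, ?_⟩
    · rw [← LinearMap.comp_assoc, hk, Submodule.liftQ_mkQ]
    · apply Subtype.ext
      rw [PowerOver.comp_val, PowerOver.comp_val]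
      refine LinearMap.ext fun x => ?_
      have : (LinearMap.range (f.1 - g.1)).mkQ (f.1 x) =
          (LinearMap.range (f.1 - g.1)).mkQ (g.1 x) :=
        (Submodule.Quotient.eq _).2 ⟨x, rfl⟩
      simp only [LinearMap.comp_apply, this]
  nonempty := ⟨⟨0, 0⟩⟩

/-- `E` is the colimit of all powers of `T` over it; a final functor from a directed set replaces
the filtered category by a directed system. -/
theorem isDirectLimitOfCopies_of_factorsThroughPowers [Module.Finite R T]
    (h : FactorsThroughPowers R T E) : IsDirectLimitOfCopies R T E := by
  classical
  have := PowerOver.isFiltered h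
  obtain ⟨ι, _, _, _, F, hF⟩ := IsFiltered.exists_directed (PowerOver R T E)
  have hfin := (Functor.final_iff_of_isFiltered F).1 hF
  let f : ∀ i j, i ≤ j → (Fin (F.obj i).n → T) →ₗ[R] (Fin (F.obj j).n → T) :=
    fun i j hij => (F.map (homOfLE hij)).1
  have hdir : DirectedSystem (fun i => Fin (F.obj i).n → T) fun i j h => f i j h :=
    { map_self := fun i x => by
        change (F.map (𝟙 i)).1 x = x
        rw [F.map_id]; rfl
      map_map := fun i j k hij hjk x => by
        change (F.map (homOfLE hij) ≫ F.map (homOfLE hjk)).1 x = (F.map (homOfLE _)).1 x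
        rw [← F.map_comp]; rfl }
  let Φ : Module.DirectLimit (fun i => Fin (F.obj i).n → T) f →ₗ[R] E :=
    Module.DirectLimit.lift R ι _ f (fun i => (F.obj i).toMap) fun i j hij x =>
      LinearMap.congr_fun (F.map (homOfLE hij)).2 x
  have hinj : Function.Injective Φ := by
    rw [injective_iff_map_eq_zero]
    intro z hz
    obtain ⟨i, x, rfl⟩ := Module.DirectLimit.exists_of z
    simp only [Φ, Module.DirectLimit.lift_of] at hz
    -- Factoring through the quotient by `x` yields an arrow `s` out of stage `i` that kills `x`.
    obtain ⟨n, l, k, hk⟩ := h ((Fin (F.obj i).n → T) ⧸ Submodule.span R {x})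
      ((Submodule.span R {x}).liftQ (F.obj i).toMap (by simpa [Submodule.span_le] using hz))
    let c : PowerOver R T E := ⟨n, k⟩
    let s : F.obj i ⟶ c := ⟨l ∘ₗ Submodule.mkQ _, by
      rw [← LinearMap.comp_assoc, hk, Submodule.liftQ_mkQ]⟩
    have hs : s.1 x = 0 := by
      have : (Submodule.span R {x}).mkQ x = 0 :=
        (Submodule.Quotient.mk_eq_zero _).2 (Submodule.mem_span_singleton_self x)
      change l ((Submodule.span R {x}).mkQ x) = 0
      rw [this, map_zero]
    obtain ⟨j, ⟨t⟩⟩ := hfin.1 c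
    obtain ⟨k₀, hik, hjk⟩ := exists_ge_ge i j
    -- Finality makes the transition map agree, at a later stage, with an arrow passing through `s`,
    -- so `x` dies in the system.
    obtain ⟨m, r, hr⟩ := hfin.2 (F.map (homOfLE hik)) (s ≫ t ≫ F.map (homOfLE hjk))
    have him : i ≤ m := hik.trans (leOfHom r)
    have hx : f i m him x = 0 := by
      have h1 : F.map (homOfLE him) = (s ≫ t ≫ F.map (homOfLE hjk)) ≫ F.map r := by
        rw [← hr, ← F.map_comp]; rfl
      change (F.map (homOfLE him)).1 x = 0
      rw [h1]
      simp only [PowerOver.comp_val, LinearMap.comp_apply, hs, map_zero]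
    rw [← Module.DirectLimit.of_f (hij := him), hx, map_zero]
  have hsurj : Function.Surjective Φ := by
    intro e
    obtain ⟨n, l, k, hk⟩ := h R (LinearMap.toSpanSingleton R E e)
    let c : PowerOver R T E := ⟨n, k⟩
    obtain ⟨i, ⟨t⟩⟩ := hfin.1 c
    refine ⟨Module.DirectLimit.of R ι _ f i (t.1 (l 1)), ?_⟩
    simp only [Φ, Module.DirectLimit.lift_of]
    have h1 := LinearMap.congr_fun t.2 (l 1)
    have h2 := LinearMap.congr_fun hk 1
    simp only [LinearMap.comp_apply, LinearMap.toSpanSingleton_apply, one_smul] at h1 h2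
    rw [h1, ← h2]
  exact ⟨ι, inferInstance, inferInstance, inferInstance, fun i => (F.obj i).n, f, hdir,
    ⟨(LinearEquiv.ofBijective Φ ⟨hinj, hsurj⟩).symm⟩⟩

end Lazard

theorem factorsThroughPowers_of_fgSubmodulesTorsionless {A B : Type u} [Ring A] [Ring B]
    {U : Type u} [AddCommGroup U] [Module A U] [Module B U] [SMulCommClass A B U]
    [SMulCommClass B A U] [IsNoetherianRing B] [Module.Finite B U] {E : Type u} [AddCommGroup E]
    [Module A E] [Module.Injective A E] (h : FGSubmodulesTorsionless A U E) :
    FactorsThroughPowers A U E := by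
  intro X _ _ _ g
  obtain ⟨n, j, hj⟩ := exists_injective_pi_of_torsionless (A := A) (B := B) (U := U)
    (h (LinearMap.range g) (Module.Finite.iff_fg.1 inferInstance))
  obtain ⟨k, hk⟩ := Module.Injective.out j hj (LinearMap.range g).subtype
  exact ⟨n, j ∘ₗ g.rangeRestrict, k, LinearMap.ext fun x => hk _⟩

end UDom

/-! ### Strong grade of `Ext¹` through the connecting homomorphism -/

namespace UDom

open CategoryTheory

section Ext

variable {A B : Type u} [Ring A] [Ring B] {U : Type u} [AddCommGroup U] [Module A U] [Module B U]
  [SMulCommClass A B U] [SMulCommClass B A U]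
  {K F M : Type u} [AddCommGroup K] [Module A K] [AddCommGroup F] [Module A F]
  [AddCommGroup M] [Module A M] {i : K →ₗ[A] F} {π : F →ₗ[A] M}

/-- The short complex `K → F → M` of modules with `π ∘ i = 0`. -/
abbrev shortComplexOfExact (hex : Function.Exact i π) : ShortComplex (ModuleCat.{u} A) :=
  ShortComplex.mk (ModuleCat.ofHom i) (ModuleCat.ofHom π) (by
    rw [← ModuleCat.ofHom_comp, hex.linearMap_comp_eq_zero]; rfl)

theorem shortExact_shortComplexOfExact (hi : Function.Injective i) (hex : Function.Exact i π)
    (hπ : Function.Surjective π) : (shortComplexOfExact hex).ShortExact where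
  exact := (ShortComplex.ShortExact.moduleCat_exact_iff_function_exact _).2 hex
  mono_f := (ModuleCat.mono_iff_injective _).2 hi
  epi_g := (ModuleCat.epi_iff_surjective _).2 hπ

variable (B) in
/-- The connecting homomorphism `Hom_A(K, U) → Ext¹_A(M, U)` as a map of `B`-modules. -/
noncomputable def connectingMap (hi : Function.Injective i) (hex : Function.Exact i π)
    (hπ : Function.Surjective π) : (K →ₗ[A] U) →ₗ[B] ExtU A U B M 1 where
  toFun φ := (shortExact_shortComplexOfExact hi hex hπ).extClass.comp
    (Abelian.Ext.mk₀ (ModuleCat.ofHom φ)) (add_zero 1)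
  map_add' φ ψ := by
    rw [ModuleCat.ofHom_add, Abelian.Ext.mk₀_add]
    exact Abelian.Ext.comp_add _ _ _ _
  map_smul' b φ := by
    have h : ModuleCat.ofHom (b • φ) = ModuleCat.ofHom φ ≫ mulHom A B U b := rfl
    rw [h, ← Abelian.Ext.mk₀_comp_mk₀]
    exact (Abelian.Ext.comp_assoc_of_third_deg_zero _ _ _ _).symm

theorem connectingMap_eq_zero_iff (hi : Function.Injective i) (hex : Function.Exact i π)
    (hπ : Function.Surjective π) (φ : K →ₗ[A] U) :
    connectingMap B hi hex hπ φ = 0 ↔ ∃ g : F →ₗ[A] U, g ∘ₗ i = φ := by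
  constructor
  · intro h
    obtain ⟨x, hx⟩ := Abelian.Ext.contravariant_sequence_exact₁
      (shortExact_shortComplexOfExact hi hex hπ) (Y := ModuleCat.of A U) _ (add_zero 1) h
    obtain ⟨g, rfl⟩ := Abelian.Ext.homEquiv₀.symm.surjective x
    refine ⟨g.hom, ?_⟩
    rw [Abelian.Ext.homEquiv₀_symm_apply, Abelian.Ext.mk₀_comp_mk₀] at hx
    have := Abelian.Ext.homEquiv₀.symm.injective hx
    exact congrArg ModuleCat.Hom.hom this
  · rintro ⟨g, rfl⟩
    have h : ModuleCat.ofHom (g ∘ₗ i) = ModuleCat.ofHom i ≫ ModuleCat.ofHom g := rfl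
    change (shortExact_shortComplexOfExact hi hex hπ).extClass.comp
      (Abelian.Ext.mk₀ (ModuleCat.ofHom (g ∘ₗ i))) (add_zero 1) = 0
    rw [h, ← Abelian.Ext.mk₀_comp_mk₀]
    exact (shortExact_shortComplexOfExact hi hex hπ).extClass_comp_assoc _

theorem connectingMap_surjective [Module.Projective A F] (hi : Function.Injective i)
    (hex : Function.Exact i π) (hπ : Function.Surjective π) :
    Function.Surjective (connectingMap B (U := U) hi hex hπ) := by
  intro y
  obtain ⟨x, hx⟩ := Abelian.Ext.contravariant_sequence_exact₃
    (shortExact_shortComplexOfExact hi hex hπ) (Y := ModuleCat.of A U) (n₁ := 1) y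
    (Abelian.Ext.eq_zero_of_projective (P := ModuleCat.of A F) _) (n₀ := 0) (add_zero 1)
  obtain ⟨g, rfl⟩ := Abelian.Ext.homEquiv₀.symm.surjective x
  exact ⟨g.hom, hx⟩

end Ext

theorem gradeGE_one_iff {R T X : Type u} [Ring R] [AddCommGroup T] [Module R T]
    [AddCommGroup X] [Module R X] : GradeGE R T X 1 ↔ ∀ f : X →ₗ[R] T, f = 0 := by
  constructor
  · intro h f
    have := h 0 one_pos
    have := Abelian.Ext.homEquiv₀.symm.injective
      (Subsingleton.elim (Abelian.Ext.homEquiv₀.symm (ModuleCat.ofHom f))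
        (Abelian.Ext.homEquiv₀.symm 0))
    exact congrArg ModuleCat.Hom.hom this
  · intro h i hi
    obtain rfl : i = 0 := Nat.lt_one_iff.1 hi
    refine ⟨fun x y => Abelian.Ext.homEquiv₀.injective (ModuleCat.hom_ext ?_)⟩
    rw [h (Abelian.Ext.homEquiv₀ x).hom, h (Abelian.Ext.homEquiv₀ y).hom]

section

variable {A B : Type u} [Ring A] [Ring B] {U : Type u} [AddCommGroup U] [Module A U] [Module B U]

/-- Every class in `Ext¹` is some `δ φ`, and `b` annihilates it exactly when `b • φ` extends. A map
to `U` from the cyclic module it generates, with value `u`, exists iff this annihilator kills `u`;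
cyclic submodules suffice. -/
theorem strongGradeExtGE_one_iff [SMulCommClass A B U] [SMulCommClass B A U]
    [IsNoetherianRing A] :
    StrongGradeExtGE A B U 1 1 ↔ ExtensionObstructionsDetect A B U := by
  constructor
  · intro h n K φ u hu
    let δ := connectingMap B (U := U) K.injective_subtype (LinearMap.exact_subtype_mkQ K)
      K.mkQ_surjective
    let σ := LinearMap.toSpanSingleton B (ExtU A U B ((Fin n → A) ⧸ K) 1) (δ φ)
    let f : LinearMap.range σ →ₗ[B] U :=
      (LinearMap.ker σ).liftQ (LinearMap.toSpanSingleton B U u) (by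
        intro b hb
        refine hu b ((connectingMap_eq_zero_iff (B := B) K.injective_subtype
          (LinearMap.exact_subtype_mkQ K) K.mkQ_surjective _).1 ?_)
        exact (map_smul δ b φ).trans hb) ∘ₗ σ.quotKerEquivRange.symm.toLinearMap
    have hf : f = 0 := gradeGE_one_iff.1 (h ((Fin n → A) ⧸ K) (LinearMap.range σ)) f
    have := LinearMap.congr_fun hf (σ.quotKerEquivRange ((LinearMap.ker σ).mkQ 1))
    simp only [f, LinearMap.comp_apply, LinearEquiv.coe_coe, LinearEquiv.symm_apply_apply,
      LinearMap.zero_apply] at this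
    exact (one_smul B u).symm.trans this
  · intro h M _ _ _ Y
    rw [gradeGE_one_iff]
    intro f
    ext y
    obtain ⟨n, π, hπ⟩ := Module.Finite.exists_fin' A M
    let K := LinearMap.ker π
    obtain ⟨φ, hφ⟩ := connectingMap_surjective (B := B) (U := U) K.injective_subtype
      (LinearMap.exact_subtype_ker_map π) hπ y
    refine h n K φ (f y) fun b hb => ?_
    rw [← connectingMap_eq_zero_iff (B := B) K.injective_subtype
      (LinearMap.exact_subtype_ker_map π) hπ, map_smul, hφ] at hb
    rw [← map_smul, show b • y = 0 from Subtype.ext hb, map_zero]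

/-! ### Left-right symmetry of the tilting bimodule -/

section AddClosure

variable [SMulCommClass A B U] [SMulCommClass B A U] {X : Type u} [AddCommGroup X] [Module A X]

theorem exists_spanning_dual_of_isInAdd
    (hB : Function.Bijective (Module.toModuleEnd A U : B →+* Module.End A U))
    (hX : IsInAdd A U X) : ∃ (n : ℕ) (s : X →ₗ[A] (Fin n → U)) (p : (Fin n → U) →ₗ[A] X),
      p ∘ₗ s = LinearMap.id ∧ ∀ φ : X →ₗ[A] U, ∃ b : Fin n → B,
        (φ = ∑ i, b i • (LinearMap.proj i ∘ₗ s)) ∧ ∀ w, φ (p w) = ∑ i, b i • w i := by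
  obtain ⟨n, s, p, hsp⟩ := hX
  refine ⟨n, s, p, hsp, fun φ => ?_⟩
  choose b hb using fun i => hB.2 (φ ∘ₗ p ∘ₗ LinearMap.single A (fun _ => U) i)
  have h (w : Fin n → U) : φ (p w) = ∑ i, b i • w i := by
    conv_lhs => rw [← Finset.univ_sum_single w, map_sum, map_sum]
    exact Finset.sum_congr rfl fun i _ => (LinearMap.congr_fun (hb i) (w i)).symm
  refine ⟨b, ?_, h⟩
  ext x
  have := LinearMap.congr_fun hsp x
  simp only [LinearMap.comp_apply, LinearMap.id_apply] at this
  rw [← this, h, this]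
  simp

theorem exists_eq_eval_of_isInAdd
    (hB : Function.Bijective (Module.toModuleEnd A U : B →+* Module.End A U))
    (hX : IsInAdd A U X) (η : (X →ₗ[A] U) →ₗ[B] U) : ∃ x : X, ∀ φ, η φ = φ x := by
  obtain ⟨n, s, p, -, h⟩ := exists_spanning_dual_of_isInAdd hB hX
  refine ⟨p fun i => η (LinearMap.proj i ∘ₗ s), fun φ => ?_⟩
  obtain ⟨b, hb, hb'⟩ := h φ
  rw [hb', hb, map_sum]
  simp only [map_smul]

end AddClosure

theorem eq_zero_of_isInAdd {X : Type u} [AddCommGroup X] [Module A X] (hX : IsInAdd A U X) (x : X)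
    (h : ∀ φ : X →ₗ[A] U, φ x = 0) : x = 0 := by
  obtain ⟨n, s, p, hsp⟩ := hX
  have hs : s x = 0 := funext fun i => h (LinearMap.proj i ∘ₗ s)
  have := LinearMap.congr_fun hsp x
  simpa [hs] using this.symm

variable [SMulCommClass A B U] [SMulCommClass B A U]

/-- Every `u` is `φ (a 1)` for some functional `φ` on `X 0`, hence a `B`-combination of the finitely
many coordinates of `a 1`. -/
theorem IsWakamatsuTilting.finite_of_bijective (hU : IsWakamatsuTilting A U)
    (hB : Function.Bijective (Module.toModuleEnd A U : B →+* Module.End A U)) :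
    Module.Finite B U := by
  obtain ⟨X, a, d, hX, -, -, -, hsurj, -⟩ := hU.coresolution
  obtain ⟨n, s, p, -, h⟩ := exists_spanning_dual_of_isInAdd hB (hX 0)
  refine ⟨Submodule.fg_iff_exists_fin_generating_family.2 ⟨n, fun i => s (a 1) i, ?_⟩⟩
  rw [eq_top_iff]
  rintro u -
  obtain ⟨φ, hφ⟩ := hsurj (LinearMap.toSpanSingleton A U u)
  obtain ⟨b, hb, -⟩ := h φ
  have : u = φ (a 1) := by
    have := LinearMap.congr_fun hφ 1
    simpa using this.symm
  rw [this, hb, LinearMap.sum_apply]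
  exact Submodule.sum_mem _ fun i _ => Submodule.smul_mem _ _ (Submodule.subset_span ⟨i, rfl⟩)

/-- For `α` in `End_B(U)`, the map `φ ↦ α (φ (a 1))` on the dual of `X 0` is evaluation at some `x`.
Functionals on `X 1` show `d 0 x = 0`, so `x = a c` by exactness, and `α` is multiplication by `c`.
-/
theorem IsWakamatsuTilting.bijective_toModuleEnd (hU : IsWakamatsuTilting A U)
    (hB : Function.Bijective (Module.toModuleEnd A U : B →+* Module.End A U)) :
    Function.Bijective (Module.toModuleEnd B U : A →+* Module.End B U) := by
  obtain ⟨X, a, d, hX, ha, had, -, hsurj, -⟩ := hU.coresolution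
  have heval (u : U) : ∃ φ : X 0 →ₗ[A] U, ∀ c, φ (a c) = c • u := by
    obtain ⟨φ, hφ⟩ := hsurj (LinearMap.toSpanSingleton A U u)
    exact ⟨φ, fun c => LinearMap.congr_fun hφ c⟩
  constructor
  · rw [injective_iff_map_eq_zero]
    intro c hc
    apply ha
    rw [map_zero]
    refine eq_zero_of_isInAdd (hX 0) _ fun φ => ?_
    have h1 : a c = c • a 1 := by rw [← map_smul, smul_eq_mul, mul_one]
    rw [h1, map_smul]
    exact LinearMap.congr_fun hc (φ (a 1))
  · intro α
    let η : (X 0 →ₗ[A] U) →ₗ[B] U :=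
      { toFun := fun φ => α (φ (a 1))
        map_add' := fun φ ψ => map_add α _ _
        map_smul' := fun b φ => map_smul α b _ }
    obtain ⟨x, hx⟩ := exists_eq_eval_of_isInAdd hB (hX 0) η
    have hdx : d 0 x = 0 := by
      refine eq_zero_of_isInAdd (hX 1) _ fun ψ => ?_
      have := hx (ψ ∘ₗ d 0)
      rw [LinearMap.comp_apply] at this
      rw [← this]
      change α (ψ (d 0 (a 1))) = 0
      rw [had.apply_apply_eq_zero, map_zero, map_zero]
    obtain ⟨c, rfl⟩ := (had x).1 hdx
    refine ⟨c, LinearMap.ext fun u => ?_⟩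
    obtain ⟨φ, hφ⟩ := heval u
    have := hx φ
    rw [hφ] at this
    change c • u = α u
    rw [← this]
    change α (φ (a 1)) = α u
    rw [hφ, one_smul]

end

/-! ### Injective envelopes and dominant dimension -/

section EnvelopeTFAE

variable {A B : Type u} [Ring A] [Ring B] {U : Type u} [AddCommGroup U] [Module A U] [Module B U]

theorem EmbedsInDirectLimit.of_injective {R T X Y : Type u} [Ring R] [AddCommGroup T] [Module R T]
    [AddCommGroup X] [Module R X] [AddCommGroup Y] [Module R Y] (h : EmbedsInDirectLimit R T Y)
    (f : X →ₗ[R] Y) (hf : Function.Injective f) : EmbedsInDirectLimit R T X := by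
  obtain ⟨L, hL, s, hs⟩ := h
  exact ⟨L, hL, s ∘ₗ f, hs.comp hf⟩

/-- The kernel of an extension of `J.aug` misses the essential submodule `M`. Thus dominant
dimension at least one can be tested on any chosen resolution. -/
theorem MinimalInjectiveResolution.exists_injective_zero {R M : Type u} [Ring R] [AddCommGroup M]
    [Module R M] (I J : MinimalInjectiveResolution R M) :
    ∃ f : I.E 0 →ₗ[R] J.E 0, Function.Injective f := by
  have := J.injective 0
  obtain ⟨f, hf⟩ := Module.Injective.out I.aug I.aug_injective J.aug
  refine ⟨f, LinearMap.ker_eq_bot.1 (I.essential_zero _ ?_)⟩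
  rw [Submodule.eq_bot_iff]
  rintro _ ⟨⟨m, rfl⟩, hm⟩
  have : J.aug m = 0 := (hf m).symm.trans hm
  rw [J.aug_injective (this.trans (map_zero _).symm), map_zero]

theorem domDimGE_one_iff {R T M : Type u} [Ring R] [AddCommGroup T] [Module R T] [AddCommGroup M]
    [Module R M] (I : MinimalInjectiveResolution R M) :
    DomDimGE R T M 1 ↔ EmbedsInDirectLimit R T (I.E 0) := by
  constructor
  · rintro ⟨J, hJ⟩
    obtain ⟨f, hf⟩ := I.exists_injective_zero J
    exact (hJ 0 one_pos).of_injective f hf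
  · intro h
    refine ⟨I, fun i hi => ?_⟩
    obtain rfl : i = 0 := Nat.lt_one_iff.1 hi
    exact h

theorem IsInAddLim.embedsInDirectLimit {R T X : Type u} [Ring R] [AddCommGroup T] [Module R T]
    [AddCommGroup X] [Module R X] (h : IsInAddLim R T X) : EmbedsInDirectLimit R T X := by
  obtain ⟨L, hL, s, p, hsp⟩ := h
  exact ⟨L, hL, s, Function.LeftInverse.injective (g := p) (LinearMap.congr_fun hsp)⟩

theorem isDirectLimitOfCopies_of_fgSubmodulesTorsionless [SMulCommClass A B U]
    [SMulCommClass B A U] [IsNoetherianRing B]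
    [Module.Finite A U] [Module.Finite B U] {E : Type u} [AddCommGroup E] [Module A E]
    [Module.Injective A E] (h : FGSubmodulesTorsionless A U E) : IsDirectLimitOfCopies A U E :=
  isDirectLimitOfCopies_of_factorsThroughPowers
    (factorsThroughPowers_of_fgSubmodulesTorsionless (B := B) h)

theorem isInAddLim_of_isDirectLimitOfCopies {R T X : Type u} [Ring R] [AddCommGroup T] [Module R T]
    [AddCommGroup X] [Module R X] (h : IsDirectLimitOfCopies R T X) : IsInAddLim R T X :=
  ⟨ModuleCat.of R X, h, LinearMap.id, LinearMap.id, rfl⟩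

end EnvelopeTFAE

end UDom

theorem proposition4p1
    (Λ Γ : Type u) [Ring Λ] [Ring Γ]
    -- both rings are left and right noetherian
    [IsNoetherianRing Λ] [IsNoetherianRing Λᵐᵒᵖ] [IsNoetherianRing Γ] [IsNoetherianRing Γᵐᵒᵖ]
    -- `U` is a `Λ`-`Γ`-bimodule (right `Γ`-modules are left modules over `Γᵐᵒᵖ`)
    (U : Type u) [AddCommGroup U] [Module Λ U] [Module Γᵐᵒᵖ U]
    [SMulCommClass Λ Γᵐᵒᵖ U] [SMulCommClass Γᵐᵒᵖ Λ U]
    (hU : UDom.IsWakamatsuTilting Λ U)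
    -- `Γ` is the endomorphism ring of the left `Λ`-module `U` (acting on the right)
    (hΓ : Function.Bijective (Module.toModuleEnd Λ U : Γᵐᵒᵖ →+* Module.End Λ U))
    -- minimal injective resolutions of `U` as a left `Λ`-module and as a right `Γ`-module
    (I : UDom.MinimalInjectiveResolution Λ U)
    (I' : UDom.MinimalInjectiveResolution Γᵐᵒᵖ U) :
    List.TFAE [
      UDom.DomDimGE Λ U U 1,
      UDom.StrongGradeExtGE Λ Γᵐᵒᵖ U 1 1,
      UDom.IsInAddLim Λ U (I.E 0),
      UDom.DoubleDualPreservesMono Λ Γᵐᵒᵖ U,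
      UDom.DomDimGE Γᵐᵒᵖ U U 1,
      UDom.StrongGradeExtGE Γᵐᵒᵖ Λ U 1 1,
      UDom.IsInAddLim Γᵐᵒᵖ U (I'.E 0),
      UDom.DoubleDualPreservesMono Γᵐᵒᵖ Λ U] := by
  have := hU.finite
  have := hU.finite_of_bijective hΓ
  have hΛ := hU.bijective_toModuleEnd hΓ
  have := I.injective 0
  have := I'.injective 0
  rw [UDom.domDimGE_one_iff I, UDom.domDimGE_one_iff I', UDom.strongGradeExtGE_one_iff,
    UDom.strongGradeExtGE_one_iff]
  tfae_have 3 → 1 := fun h => h.embedsInDirectLimit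
  tfae_have 7 → 5 := fun h => h.embedsInDirectLimit
  tfae_have 1 → 6 := fun h =>
    UDom.extensionObstructionsDetect_of_fgSubmodulesTorsionless hΓ I.aug I.aug_injective
      (UDom.fgSubmodulesTorsionless_of_embedsInDirectLimit h)
  tfae_have 5 → 2 := fun h =>
    UDom.extensionObstructionsDetect_of_fgSubmodulesTorsionless hΛ I'.aug I'.aug_injective
      (UDom.fgSubmodulesTorsionless_of_embedsInDirectLimit h)
  tfae_have 2 → 4 := UDom.doubleDualPreservesMono_of_extensionObstructionsDetect
  tfae_have 6 → 8 := UDom.doubleDualPreservesMono_of_extensionObstructionsDetect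
  tfae_have 4 → 3 := fun h => UDom.isInAddLim_of_isDirectLimitOfCopies
    (UDom.isDirectLimitOfCopies_of_fgSubmodulesTorsionless (B := Γᵐᵒᵖ)
      (UDom.fgSubmodulesTorsionless_of_doubleDualPreservesMono I.aug I.aug_injective
        I.essential_zero h))
  tfae_have 8 → 7 := fun h => UDom.isInAddLim_of_isDirectLimitOfCopies
    (UDom.isDirectLimitOfCopies_of_fgSubmodulesTorsionless (B := Λ)
      (UDom.fgSubmodulesTorsionless_of_doubleDualPreservesMono I'.aug I'.aug_injective
        I'.essential_zero h))
  tfae_finish
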